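/- Let $(\Omega,\Sigma,\mu)$ be a probability space and let $\varphi\colon\Omega\to\Omega$ be a measurable map with $\mu(\varphi^{-1}(A))=\mu(A)$ for all $A\in\Sigma$. Assume that $\varphi$ is bimeasurable, i.e. also $\varphi(A)\in\Sigma$ for every $A\in\Sigma$. Let $L^1=L^1(\Omega,\Sigma,\mu)$ be the space of (classes of) real-valued integrable functions, and let $P\colon L^1\to L^1$ be the Perron–Frobenius operator, i.e. the unique positive linear operator with $$\int_A Pf\,d\mu=\int_{\varphi^{-1}(A)}f\,d\mu\qquad(f\in L^1,\ A\in\Sigma).$$ Write $A\sim B$ if $\mu(A\triangle B)=0$, and let $\Sigma/{\sim}$ be the measure algebra with the metric $d(A,B)=\mu(A\triangle B)$. Put $$\Sigma_\infty=\bigcap_{n\in\mathbb N}\{\varphi^{-n}(A):A\in\Sigma\},\qquad \Sigma_{\mathrm{inv}}=\{A\in\Sigma:\varphi^{-1}(A)=A\},$$ and for a sub-$\sigma$-algebra $\mathcal A\subseteq\Sigma$ let $\overline{\mathcal A}=\{A\in\Sigma: A\sim B\text{ for some }B\in\mathcal A\}$ be its completion within $\Sigma$. For $A\subseteq\Omega$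 let the minimal invariant superset $A^*$ be the intersection of all $B\subseteq\Omega$ with $A\subseteq B$ and $\varphi^{-1}(B)=B$. Then the following assertions are equivalent: (i) for every $A\in\Sigma$ the sequence $(\varphi^n(A))_{n\in\mathbb N}$ converges in $\Sigma/{\sim}$; (ii) for every $f\in L^1$ the sequence $(P^nf)_{n\in\mathbb N}$ converges in $L^1$; (iii) $\overline{\Sigma_\infty}=\overline{\Sigma_{\mathrm{inv}}}$. If these equivalent assertions hold, then for every $f\in L^1$ the sequence $(P^nf)_{n\in\mathbb N}$ converges in $L^1$ to the conditional expectation $\mathbb E(f\mid\Sigma_{\mathrm{inv}})$, and for every $A\in\Sigma$ the set $A^*$ belongs to $\Sigma$ and $(\varphi^n(A))_{n\in\mathbb N}$ converges to $A^*$ in $\Sigma/{\sim}$. -/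

import Mathlib

open MeasureTheory Filter Topology
open scoped symmDiff

noncomputable section

namespace PerronFrobenius

/-- A self-map is bimeasurable if preimages and images of measurable sets are measurable. -/
structure Bimeasurable {Ω : Type*} [MeasurableSpace Ω] (φ : Ω → Ω) : Prop where
  measurable : Measurable φ
  measurableSet_image : ∀ A : Set Ω, MeasurableSet A → MeasurableSet (φ '' A)

theorem Bimeasurable.measurableSet_iterate_image {Ω : Type*} [MeasurableSpace Ω] {φ : Ω → Ω}
    (hφ : Bimeasurable φ) (n : ℕ) {A : Set Ω} (hA : MeasurableSet A) :
    MeasurableSet (φ^[n] '' A) := by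
  induction n with
  | zero => simpa using hA
  | succ n ih =>
    rw [Function.iterate_succ', Set.image_comp]
    exact hφ.measurableSet_image _ ih

/-- The measure algebra `Σ/∼`: measurable sets modulo `μ (A ∆ B) = 0`, with the metric
`d(A, B) = μ (A ∆ B)`. (`MeasuredSets μ` is the space of measurable sets with this pseudometric.) -/
abbrev MeasureAlgebra {Ω : Type*} [MeasurableSpace Ω] (μ : Measure Ω) : Type _ :=
  SeparationQuotient (MeasuredSets μ)

/-- The class of a measurable set in the measure algebra. -/
def MeasureAlgebra.mk {Ω : Type*} [MeasurableSpace Ω] (μ : Measure Ω) (A : Set Ω)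
    (hA : MeasurableSet A) : MeasureAlgebra μ :=
  SeparationQuotient.mk (⟨A, hA⟩ : MeasuredSets μ)

theorem MeasureAlgebra.edist_mk {Ω : Type*} [MeasurableSpace Ω] (μ : Measure Ω) {A B : Set Ω}
    (hA : MeasurableSet A) (hB : MeasurableSet B) :
    edist (MeasureAlgebra.mk μ A hA) (MeasureAlgebra.mk μ B hB) = μ (A ∆ B) := rfl

theorem MeasureAlgebra.mk_eq_mk {Ω : Type*} [MeasurableSpace Ω] (μ : Measure Ω) {A B : Set Ω}
    (hA : MeasurableSet A) (hB : MeasurableSet B) :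
    MeasureAlgebra.mk μ A hA = MeasureAlgebra.mk μ B hB ↔ μ (A ∆ B) = 0 := by
  rw [← MeasureAlgebra.edist_mk μ hA hB, edist_eq_zero]

/-- `Σ_∞ = ⋂ n, Σ_n`, where `Σ_n = {φ⁻ⁿ(A) : A ∈ Σ}`. -/
abbrev tailSigma {Ω : Type*} [mΩ : MeasurableSpace Ω] (φ : Ω → Ω) : MeasurableSpace Ω :=
  ⨅ n : ℕ, MeasurableSpace.comap (φ^[n]) mΩ

theorem measurableSet_tailSigma {Ω : Type*} [MeasurableSpace Ω] {φ : Ω → Ω} {A : Set Ω} :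
    MeasurableSet[tailSigma φ] A ↔ ∀ n : ℕ, ∃ B, MeasurableSet B ∧ φ^[n] ⁻¹' B = A := by
  rw [MeasurableSpace.measurableSet_iInf]
  rfl

/-- The completion of a sub-σ-algebra `m` within `Σ`: all sets in `Σ` that agree with a set of `m`
up to a `μ`-null set. -/
abbrev completionWithin {Ω : Type*} (m : MeasurableSpace Ω) [mΩ : MeasurableSpace Ω]
    (μ : Measure Ω) : MeasurableSpace Ω :=
  mΩ ⊓ eventuallyMeasurableSpace m (ae μ)

theorem measurableSet_completionWithin {Ω : Type*} {m : MeasurableSpace Ω}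
    [mΩ : MeasurableSpace Ω] {μ : Measure Ω} {A : Set Ω} :
    MeasurableSet[completionWithin m μ] A ↔
      MeasurableSet[mΩ] A ∧ ∃ B, MeasurableSet[m] B ∧ μ (A ∆ B) = 0 := by
  rw [MeasurableSpace.measurableSet_inf]
  simp only [measure_symmDiff_eq_zero_iff]
  rfl

/-- The minimal invariant superset `A*`: the intersection of all (not necessarily measurable)
`B ⊇ A` with `φ⁻¹(B) = B`. -/
def minimalInvariantSuperset {Ω : Type*} (φ : Ω → Ω) (A : Set Ω) : Set Ω :=
  ⋂₀ {B | A ⊆ B ∧ φ ⁻¹' B = B}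

/-- The conditional expectation `𝔼(f | Σ_inv)` as an element of `L¹`. -/
def condExpInv {Ω : Type*} [MeasurableSpace Ω] (μ : Measure Ω) (φ : Ω → Ω) (f : Lp ℝ 1 μ) :
    Lp ℝ 1 μ :=
  (integrable_condExp (m := MeasurableSpace.invariants φ) (μ := μ) (f := f)).toL1
    (μ[f | MeasurableSpace.invariants φ])

section Operator

variable {Ω : Type*} [MeasurableSpace Ω] {μ : Measure Ω} {φ : Ω → Ω}

theorem ext_of_setIntegral_eq {f g : Lp ℝ 1 μ}
    (h : ∀ A, MeasurableSet A → ∫ x in A, f x ∂μ = ∫ x in A, g x ∂μ) : f = g :=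
  Lp.ext ((L1.integrable_coeFn f).ae_eq_of_forall_setIntegral_eq _ _ (L1.integrable_coeFn g)
    fun A hA _ => h A hA)

theorem setIntegral_add (f g : Lp ℝ 1 μ) (A : Set Ω) :
    ∫ x in A, (f + g : Lp ℝ 1 μ) x ∂μ = ∫ x in A, f x ∂μ + ∫ x in A, g x ∂μ := by
  rw [← integral_add (L1.integrable_coeFn f).integrableOn (L1.integrable_coeFn g).integrableOn]
  exact integral_congr_ae (ae_restrict_of_ae (Lp.coeFn_add f g))

theorem setIntegral_smul (c : ℝ) (f : Lp ℝ 1 μ) (A : Set Ω) :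
    ∫ x in A, (c • f : Lp ℝ 1 μ) x ∂μ = c • ∫ x in A, f x ∂μ := by
  rw [← integral_smul]
  exact integral_congr_ae (ae_restrict_of_ae (Lp.coeFn_smul c f))

/-- `P f` as the Radon-Nikodym derivative with respect to `μ` of the signed measure
`A ↦ ∫ x in φ⁻¹(A), f x ∂μ`. -/
def pfFun (μ : Measure Ω) (φ : Ω → Ω) (f : Lp ℝ 1 μ) : Lp ℝ 1 μ :=
  (SignedMeasure.integrable_rnDeriv ((μ.withDensityᵥ f).map φ) μ).toL1 _

variable [IsProbabilityMeasure μ]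

theorem setIntegral_pfFun (hφ : MeasurePreserving φ μ μ) (f : Lp ℝ 1 μ) {A : Set Ω}
    (hA : MeasurableSet A) : ∫ x in A, pfFun μ φ f x ∂μ = ∫ x in φ ⁻¹' A, f x ∂μ := by
  have hf := L1.integrable_coeFn f
  set s : SignedMeasure Ω := (μ.withDensityᵥ f).map φ with hs
  have happ : ∀ B, MeasurableSet B → s B = ∫ x in φ ⁻¹' B, f x ∂μ := fun B hB => by
    rw [hs, VectorMeasure.map_apply _ hφ.measurable hB,
      withDensityᵥ_apply hf (hφ.measurable hB)]
  have hac : VectorMeasure.AbsolutelyContinuous s μ.toENNRealVectorMeasure := by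
    refine VectorMeasure.AbsolutelyContinuous.mk fun B hB hB0 => ?_
    rw [Measure.toENNRealVectorMeasure_apply_measurable hB] at hB0
    rw [happ B hB]
    exact setIntegral_measure_zero _
      ((hφ.measure_preimage hB.nullMeasurableSet).trans hB0)
  have hrn := (SignedMeasure.absolutelyContinuous_iff_withDensityᵥ_rnDeriv_eq s μ).1 hac
  rw [← happ A hA, ← hrn, withDensityᵥ_apply (SignedMeasure.integrable_rnDeriv s μ) hA]
  refine integral_congr_ae (ae_restrict_of_ae ?_)
  exact (SignedMeasure.integrable_rnDeriv s μ).coeFn_toL1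

theorem pfFun_nonneg (hφ : MeasurePreserving φ μ μ) {f : Lp ℝ 1 μ} (hf : 0 ≤ f) :
    0 ≤ pfFun μ φ f := by
  rw [← Lp.coeFn_nonneg] at hf ⊢
  refine ae_nonneg_of_forall_setIntegral_nonneg (L1.integrable_coeFn _) fun A hA _ => ?_
  rw [setIntegral_pfFun hφ f hA]
  exact integral_nonneg_of_ae (ae_restrict_of_ae hf)

/-- `P` as a linear map. -/
def pfLinear (hφ : MeasurePreserving φ μ μ) : Lp ℝ 1 μ →ₗ[ℝ] Lp ℝ 1 μ where
  toFun := pfFun μ φ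
  map_add' f g := ext_of_setIntegral_eq fun A hA => by
    rw [setIntegral_pfFun hφ _ hA, setIntegral_add, setIntegral_add, setIntegral_pfFun hφ _ hA,
      setIntegral_pfFun hφ _ hA]
  map_smul' c f := ext_of_setIntegral_eq fun A hA => by
    rw [setIntegral_pfFun hφ _ hA, setIntegral_smul, RingHom.id_apply, setIntegral_smul,
      setIntegral_pfFun hφ _ hA]

theorem norm_pfLinear_le (hφ : MeasurePreserving φ μ μ) (f : Lp ℝ 1 μ) :
    ‖pfLinear hφ f‖ ≤ 1 * ‖f‖ := by
  have h0 : ∀ g : Lp ℝ 1 μ, ∫ x, (pfLinear hφ g) x ∂μ = ∫ x, g x ∂μ := fun g => by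
    have h := setIntegral_pfFun hφ g MeasurableSet.univ
    rw [Set.preimage_univ, setIntegral_univ, setIntegral_univ] at h
    exact h
  have hle : |pfLinear hφ f| ≤ pfLinear hφ |f| := by
    rw [abs_le', ← map_neg, ← sub_nonneg, ← map_sub, ← sub_nonneg (b := pfLinear hφ (-f)),
      ← map_sub]
    exact ⟨pfFun_nonneg hφ (sub_nonneg.2 (le_abs_self f)),
      pfFun_nonneg hφ (sub_nonneg.2 (neg_le_abs f))⟩
  have hn : ∀ g : Lp ℝ 1 μ, ‖g‖ = ∫ x, (|g| : Lp ℝ 1 μ) x ∂μ := fun g => by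
    rw [L1.norm_eq_integral_norm]
    refine integral_congr_ae ?_
    filter_upwards [Lp.coeFn_abs g] with x hx
    rw [hx, Real.norm_eq_abs]
  rw [one_mul, hn, hn f, ← h0 |f|]
  exact integral_mono_ae (L1.integrable_coeFn _) (L1.integrable_coeFn _) (Lp.coeFn_le _ _ |>.2 hle)

/-- The Perron-Frobenius operator on `L¹`. -/
def perronFrobenius (hφ : MeasurePreserving φ μ μ) : Lp ℝ 1 μ →L[ℝ] Lp ℝ 1 μ :=
  (pfLinear hφ).mkContinuous 1 (norm_pfLinear_le hφ)

/-- The defining property of the Perron-Frobenius operator. -/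
theorem setIntegral_perronFrobenius (hφ : MeasurePreserving φ μ μ) (f : Lp ℝ 1 μ) {A : Set Ω}
    (hA : MeasurableSet A) :
    ∫ x in A, perronFrobenius hφ f x ∂μ = ∫ x in φ ⁻¹' A, f x ∂μ :=
  setIntegral_pfFun hφ f hA

theorem perronFrobenius_nonneg (hφ : MeasurePreserving φ μ μ) {f : Lp ℝ 1 μ} (hf : 0 ≤ f) :
    0 ≤ perronFrobenius hφ f :=
  pfFun_nonneg hφ hf

/-- The defining property determines the operator. -/
theorem eq_perronFrobenius (hφ : MeasurePreserving φ μ μ) (Q : Lp ℝ 1 μ → Lp ℝ 1 μ)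
    (hQ : ∀ (f : Lp ℝ 1 μ) (A : Set Ω), MeasurableSet A →
      ∫ x in A, Q f x ∂μ = ∫ x in φ ⁻¹' A, f x ∂μ) : Q = perronFrobenius hφ :=
  funext fun f => ext_of_setIntegral_eq fun A hA => by
    rw [hQ f A hA, setIntegral_perronFrobenius hφ f hA]

end Operator

end PerronFrobenius

end

namespace PerronFrobenius

/-! Condition (iii) says that every set of `Σ_∞` is invariant up to a null set
(`completionWithin_eq_iff`). For functions, `(Pⁿf) ∘ φⁿ` is the conditional expectation of `f` on
`φ⁻ⁿ(Σ)` (`perronFrobenius_pow_comp_iterate`), and by Lévy's downward theorem these tend to `𝔼(f |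
Σ_∞)`. Under (iii) this is `𝔼(f | Σ_inv)`, which composition with `φⁿ` fixes; as `φⁿ` preserves `μ`,
`Pⁿf` itself converges. For sets, `φ⁻ⁿ(φⁿ(A))` has the measure of `φⁿ(A)` and increases to a set of
`Σ_∞`, which under (iii) is `A*` up to a null set. Conversely, pulling back by `φⁿ` recovers a set
of `Σ_∞` from its `n`-th image, and its indicator from `Pⁿ`. Convergence in (i) or (ii) thus makes
the set, or its indicator, a limit of pullbacks of one fixed object, and such a limit is invariant.
-/

/-- Orthogonal projections onto a decreasing sequence of closed subspaces converge strongly to the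
orthogonal projection onto the intersection. -/
theorem tendsto_starProjection_iInf {E : Type*} [NormedAddCommGroup E] [InnerProductSpace ℝ E]
    [CompleteSpace E] (K : ℕ → Submodule ℝ E) [∀ n, (K n).HasOrthogonalProjection]
    [(⨅ n, K n).HasOrthogonalProjection] (hK : Antitone K) (x : E) :
    Tendsto (fun n => (K n).starProjection x) atTop (𝓝 ((⨅ n, K n).starProjection x)) := by
  -- The complements increase, and the closure of their span is the complement of the intersection.
  have hKo : ∀ n, (K n)ᗮᗮ = K n := fun n => Submodule.orthogonal_orthogonal _
  have h := Submodule.starProjection_tendsto_closure_iSup (fun n => (K n)ᗮ)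
    (fun i j hij => Submodule.orthogonal_le (hK hij)) x
  have hcl : (⨆ n, (K n)ᗮ).topologicalClosure = (⨅ n, K n)ᗮ := by
    rw [← Submodule.orthogonal_orthogonal_eq_closure, ← Submodule.iInf_orthogonal]
    simp_rw [hKo]
  simp_rw [hcl, Submodule.starProjection_orthogonal_val] at h
  simpa using (tendsto_const_nhds (x := x)).sub h

/-! ### Downward martingale convergence in `L²`, then in `L¹` -/

section Downward

variable {Ω : Type*} [mΩ : MeasurableSpace Ω] {μ : Measure Ω}

/-- The limsup of the `F n`-measurable representatives ignores any initial segment, so it is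
measurable for every `F k`. -/
theorem aestronglyMeasurable_iInf {F : ℕ → MeasurableSpace Ω} (hF : Antitone F) {f : Ω → ℝ}
    (hf : ∀ n, AEStronglyMeasurable[F n] f μ) : AEStronglyMeasurable[⨅ n, F n] f μ := by
  choose g hgm hfg using hf
  refine ⟨fun x => limsup (fun n => g n x) atTop, ?_, ?_⟩
  · refine Measurable.stronglyMeasurable ?_
    intro s hs
    rw [MeasurableSpace.measurableSet_iInf]
    intro k
    have hk : Measurable[F k] fun x => limsup (fun n => g (n + k) x) atTop :=
      Measurable.limsup fun n => ((hgm (n + k)).mono (hF (Nat.le_add_left k n))).measurable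
    have := hk hs
    convert this using 3 with x
    exact (limsup_nat_add (fun n => g n x) k).symm
  · filter_upwards [ae_all_iff.2 hfg] with x hx
    simp [← hx]

theorem iInf_lpMeas {F : ℕ → MeasurableSpace Ω} (hF : Antitone F) :
    ⨅ n, lpMeas ℝ ℝ (F n) 2 μ = lpMeas ℝ ℝ (⨅ n, F n) 2 μ := by
  ext f
  simp only [Submodule.mem_iInf, mem_lpMeas_iff_aestronglyMeasurable]
  exact ⟨aestronglyMeasurable_iInf hF, fun h n => h.mono (iInf_le F n)⟩

theorem tendsto_eLpNorm_condExp_iInf_of_memLp_two {F : ℕ → MeasurableSpace Ω} (hF : Antitone F)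
    (hle : ∀ n, F n ≤ mΩ) {f : Ω → ℝ}
    [IsFiniteMeasure μ] (hf : MemLp f 2 μ) :
    Tendsto (fun n => eLpNorm (μ[f | F n] - μ[f | ⨅ n, F n]) 2 μ) atTop (𝓝 0) := by
  have hle' : ⨅ n, F n ≤ mΩ := (iInf_le F 0).trans (hle 0)
  have : ∀ n, Fact (F n ≤ mΩ) := fun n => ⟨hle n⟩
  have : Fact (⨅ n, F n ≤ mΩ) := ⟨hle'⟩
  have : (⨅ n, lpMeas ℝ ℝ (F n) 2 μ).HasOrthogonalProjection := by
    rw [iInf_lpMeas hF]; infer_instance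
  have h := tendsto_starProjection_iInf (fun n => lpMeas ℝ ℝ (F n) 2 μ)
    (fun i j hij g hg => by
      rw [mem_lpMeas_iff_aestronglyMeasurable] at hg ⊢
      exact hg.mono (hF hij)) hf.toLp
  simp_rw [iInf_lpMeas hF] at h
  rw [Lp.tendsto_Lp_iff_tendsto_eLpNorm'] at h
  refine h.congr fun n => eLpNorm_congr_ae ?_
  exact (hf.condExpL2_ae_eq_condExp (𝕜 := ℝ) (hle n)).sub
    (hf.condExpL2_ae_eq_condExp (𝕜 := ℝ) hle')

end Downward

section DownwardOne

variable {Ω : Type*} [mΩ : MeasurableSpace Ω] {μ : Measure Ω} [IsProbabilityMeasure μ]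

/-- Conditional expectations along a decreasing sequence of σ-algebras converge in `L¹`
(**Lévy's downward theorem**). -/
theorem tendsto_eLpNorm_condExp_iInf {F : ℕ → MeasurableSpace Ω} (hF : Antitone F)
    (hle : ∀ n, F n ≤ mΩ) {f : Ω → ℝ} (hf : Integrable f μ) :
    Tendsto (fun n => eLpNorm (μ[f | F n] - μ[f | ⨅ n, F n]) 1 μ) atTop (𝓝 0) := by
  rw [ENNReal.tendsto_nhds_zero]
  intro ε hε
  -- A simple function lies in `L²`; contractivity of conditional expectation in `L¹` controls the
  -- other two thirds.
  obtain ⟨g, hfg, -⟩ := (memLp_one_iff_integrable.2 hf).exists_simpleFunc_eLpNorm_sub_lt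
    ENNReal.one_ne_top (ENNReal.div_pos hε.ne' (by simp : (3 : ENNReal) ≠ ⊤)).ne'
  have hg2 : MemLp g 2 μ := SimpleFunc.memLp_of_isFiniteMeasure g 2 μ
  have hg : Integrable g μ := hg2.integrable one_le_two
  filter_upwards [ENNReal.tendsto_nhds_zero.1
    (tendsto_eLpNorm_condExp_iInf_of_memLp_two hF hle hg2) (ε / 3)
    (ENNReal.div_pos hε.ne' (by simp))] with n hn
  have hclose : ∀ m : MeasurableSpace Ω, eLpNorm (μ[f | m] - μ[g | m]) 1 μ ≤ ε / 3 := fun m => by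
    rw [eLpNorm_congr_ae (condExp_sub hf hg m).symm]
    exact (eLpNorm_condExp_le_eLpNorm _ le_rfl).trans hfg.le
  have hsplit : μ[f | F n] - μ[f | ⨅ n, F n] = ((μ[f | F n] - μ[g | F n]) +
      (μ[g | F n] - μ[g | ⨅ n, F n])) - (μ[f | ⨅ n, F n] - μ[g | ⨅ n, F n]) := by abel
  have hm : ∀ (m : MeasurableSpace Ω) (u : Ω → ℝ), AEStronglyMeasurable[mΩ] (μ[u | m]) μ :=
    fun m u => integrable_condExp.aestronglyMeasurable
  calc eLpNorm (μ[f | F n] - μ[f | ⨅ n, F n]) 1 μ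
      ≤ eLpNorm ((μ[f | F n] - μ[g | F n]) + (μ[g | F n] - μ[g | ⨅ n, F n])) 1 μ +
        eLpNorm (μ[f | ⨅ n, F n] - μ[g | ⨅ n, F n]) 1 μ := by
        rw [hsplit]
        exact eLpNorm_sub_le (((hm _ _).sub (hm _ _)).add ((hm _ _).sub (hm _ _)))
          ((hm _ _).sub (hm _ _)) le_rfl
    _ ≤ (eLpNorm (μ[f | F n] - μ[g | F n]) 1 μ +
          eLpNorm (μ[g | F n] - μ[g | ⨅ n, F n]) 1 μ) + ε / 3 :=
        add_le_add (eLpNorm_add_le ((hm _ _).sub (hm _ _)) ((hm _ _).sub (hm _ _)) le_rfl)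
          (hclose _)
    _ ≤ (ε / 3 + ε / 3) + ε / 3 := by
        gcongr
        · exact hclose _
        · exact (eLpNorm_le_eLpNorm_of_exponent_le one_le_two
            ((hm _ _).sub (hm _ _))).trans hn
    _ = ε := ENNReal.add_thirds ε

/-- Conditional expectations only depend on the σ-algebra up to null sets. -/
theorem condExp_ae_eq_of_forall_exists_ae_eq {m m' : MeasurableSpace Ω} (hmm' : m ≤ m')
    (hm' : m' ≤ mΩ) (h : ∀ s, MeasurableSet[m'] s → ∃ t, MeasurableSet[m] t ∧ s =ᵐ[μ] t)
    {f : Ω → ℝ} (hf : Integrable f μ) : μ[f | m] =ᵐ[μ] μ[f | m'] := by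
  refine ae_eq_condExp_of_forall_setIntegral_eq hm' hf
    (fun _ _ _ => integrable_condExp.integrableOn) (fun s hs _ => ?_)
    (stronglyMeasurable_condExp.mono hmm').aestronglyMeasurable
  obtain ⟨t, ht, hst⟩ := h s hs
  rw [setIntegral_congr_set hst, setIntegral_congr_set hst,
    setIntegral_condExp (hmm'.trans hm') hf ht]

end DownwardOne

/-! ### Orbits and the minimal invariant superset -/

section Orbits

variable {Ω : Type*} {φ : Ω → Ω}

theorem preimage_iterate_eq {B : Set Ω} (hB : φ ⁻¹' B = B) (n : ℕ) : φ^[n] ⁻¹' B = B := by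
  rw [Set.preimage_iterate_eq]
  exact Function.iterate_fixed hB n

theorem monotone_preimage_image_iterate (φ : Ω → Ω) (A : Set Ω) :
    Monotone fun n : ℕ => φ^[n] ⁻¹' (φ^[n] '' A) := by
  refine monotone_nat_of_le_succ fun n => ?_
  rintro x ⟨a, ha, hax⟩
  refine ⟨a, ha, ?_⟩
  rw [Function.iterate_succ_apply', Function.iterate_succ_apply', hax]

theorem subset_minimalInvariantSuperset (φ : Ω → Ω) (A : Set Ω) :
    A ⊆ minimalInvariantSuperset φ A :=
  Set.subset_sInter fun _ hB => hB.1

theorem preimage_minimalInvariantSuperset (φ : Ω → Ω) (A : Set Ω) :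
    φ ⁻¹' minimalInvariantSuperset φ A = minimalInvariantSuperset φ A := by
  rw [minimalInvariantSuperset, Set.preimage_sInter]
  ext x
  simp only [Set.mem_iInter, Set.mem_sInter]
  exact forall₂_congr fun B hB => by rw [hB.2]

/-- The union consists of the points whose forward orbit meets that of a point of `A`. Being
countable, it yields measurability. -/
theorem minimalInvariantSuperset_eq_iUnion (φ : Ω → Ω) (A : Set Ω) :
    minimalInvariantSuperset φ A = ⋃ m : ℕ, ⋃ n : ℕ, φ^[m] ⁻¹' (φ^[n] '' A) := by
  refine Set.Subset.antisymm (Set.sInter_subset_of_mem ⟨fun x hx => ?_, ?_⟩) ?_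
  · exact Set.mem_iUnion₂.2 ⟨0, 0, x, hx, rfl⟩
  · ext x
    simp only [Set.mem_preimage, Set.mem_iUnion, Set.mem_image]
    constructor
    · rintro ⟨m, n, a, ha, h⟩
      exact ⟨m + 1, n, a, ha, h⟩
    · rintro ⟨m, n, a, ha, h⟩
      refine ⟨m, n + 1, a, ha, ?_⟩
      rw [Function.iterate_succ_apply', h, ← Function.iterate_succ_apply' φ m,
        Function.iterate_succ_apply]
  · refine Set.iUnion₂_subset fun m n => ?_
    have hinv := preimage_minimalInvariantSuperset φ A
    rintro x ⟨a, ha, hax⟩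
    have ha' : a ∈ φ^[n] ⁻¹' minimalInvariantSuperset φ A := by
      rw [preimage_iterate_eq hinv]
      exact subset_minimalInvariantSuperset φ A ha
    rw [← preimage_iterate_eq hinv m, Set.mem_preimage, ← hax]
    exact ha'

theorem image_iterate_subset_minimalInvariantSuperset (φ : Ω → Ω) (A : Set Ω) (n : ℕ) :
    φ^[n] '' A ⊆ minimalInvariantSuperset φ A := by
  rw [minimalInvariantSuperset_eq_iUnion]
  exact fun x hx => Set.mem_iUnion₂.2 ⟨0, n, hx⟩

end Orbits

/-! ### Tail sets and convergence of images -/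

section Sets

variable {Ω : Type*} [mΩ : MeasurableSpace Ω] {μ : Measure Ω} {φ : Ω → Ω}

theorem antitone_comap_iterate (hφ : Measurable φ) :
    Antitone fun n : ℕ => MeasurableSpace.comap (φ^[n]) mΩ := by
  refine antitone_nat_of_succ_le fun n => ?_
  rw [Function.iterate_succ', ← MeasurableSpace.comap_comp]
  exact MeasurableSpace.comap_mono hφ.comap_le

theorem invariants_le_tailSigma (φ : Ω → Ω) :
    MeasurableSpace.invariants φ ≤ tailSigma φ := fun B hB => by
  rw [MeasurableSpace.measurableSet_invariants] at hB
  exact measurableSet_tailSigma.2 fun n => ⟨B, hB.1, preimage_iterate_eq hB.2 n⟩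

theorem tailSigma_le (φ : Ω → Ω) : tailSigma φ ≤ mΩ := by
  refine (iInf_le _ 0).trans ?_
  rw [Function.iterate_zero, MeasurableSpace.comap_id]

/-- The completions of `Σ_∞` and `Σ_inv` agree iff every set in `Σ_∞` is invariant up to a
null set. -/
theorem completionWithin_eq_iff (hφ : MeasurePreserving φ μ μ) :
    completionWithin (tailSigma φ) μ = completionWithin (MeasurableSpace.invariants φ) μ ↔
      ∀ A, MeasurableSet[tailSigma φ] A → φ ⁻¹' A =ᵐ[μ] A := by
  constructor
  · intro h A hA
    have hA' : MeasurableSet[completionWithin (tailSigma φ) μ] A :=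
      measurableSet_completionWithin.2 ⟨tailSigma_le φ A hA, A, hA, by simp⟩
    rw [h] at hA'
    obtain ⟨-, B, hB, hAB⟩ := measurableSet_completionWithin.1 hA'
    rw [measure_symmDiff_eq_zero_iff] at hAB
    have := hφ.quasiMeasurePreserving.preimage_ae_eq hAB
    rw [(MeasurableSpace.measurableSet_invariants.1 hB).2] at this
    exact this.trans hAB.symm
  · intro h
    ext A
    rw [measurableSet_completionWithin, measurableSet_completionWithin]
    refine and_congr_right fun _ => ⟨?_, ?_⟩
    · rintro ⟨B, hB, hAB⟩
      obtain ⟨C, hC, hCB, hCinv⟩ :=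
        hφ.quasiMeasurePreserving.exists_preimage_eq_of_preimage_ae
          (tailSigma_le φ B hB).nullMeasurableSet (h B hB)
      refine ⟨C, MeasurableSpace.measurableSet_invariants.2 ⟨hC, hCinv⟩, ?_⟩
      rw [measure_symmDiff_eq_zero_iff] at hAB ⊢
      exact hAB.trans hCB.symm
    · rintro ⟨B, hB, hAB⟩
      exact ⟨B, invariants_le_tailSigma φ B hB, hAB⟩

/-- If the preimages `φ⁻ⁿ(C)` converge to `A`, then `A` is invariant up to a null set. -/
theorem preimage_ae_eq_of_tendsto (hφ : MeasurePreserving φ μ μ) {A C : Set Ω}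
    (hA : MeasurableSet A) (hC : MeasurableSet C)
    (h : Tendsto (fun n : ℕ => μ (A ∆ (φ^[n] ⁻¹' C))) atTop (𝓝 0)) : φ ⁻¹' A =ᵐ[μ] A := by
  rw [← measure_symmDiff_eq_zero_iff]
  -- Both `φ⁻¹(A)` and `A` are compared with `φ⁻⁽ⁿ⁺¹⁾(C)`.
  have hle : ∀ n : ℕ, μ ((φ ⁻¹' A) ∆ A) ≤
      μ (A ∆ (φ^[n] ⁻¹' C)) + μ (A ∆ (φ^[n + 1] ⁻¹' C)) := fun n => by
    have hpre : μ (A ∆ (φ^[n] ⁻¹' C)) = μ ((φ ⁻¹' A) ∆ (φ^[n + 1] ⁻¹' C)) := by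
      rw [← hφ.measure_preimage
        (hA.symmDiff (hφ.measurable.iterate n hC)).nullMeasurableSet, Set.preimage_symmDiff,
        Function.iterate_succ, Set.preimage_comp]
    rw [hpre, symmDiff_comm A]
    exact measure_symmDiff_le _ _ _
  have hlim := h.add (h.comp (tendsto_add_atTop_nat 1))
  rw [add_zero] at hlim
  exact le_antisymm (ge_of_tendsto' hlim hle) bot_le

theorem preimage_image_iterate_of_tailSigma {A : Set Ω} (hA : MeasurableSet[tailSigma φ] A)
    (n : ℕ) : φ^[n] ⁻¹' (φ^[n] '' A) = A := by
  obtain ⟨B, -, rfl⟩ := measurableSet_tailSigma.1 hA n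
  rw [Set.preimage_image_preimage]

/-- The union is increasing, so its first `k` terms can be dropped; the others lie in `φ⁻ᵏ(Σ)`. -/
theorem measurableSet_tailSigma_iUnion (hbi : Bimeasurable φ) {A : Set Ω}
    (hA : MeasurableSet A) :
    MeasurableSet[tailSigma φ] (⋃ n : ℕ, φ^[n] ⁻¹' (φ^[n] '' A)) := by
  refine (MeasurableSpace.measurableSet_iInf).2 fun k => ?_
  rw [← (monotone_preimage_image_iterate φ A).iUnion_nat_add k]
  exact MeasurableSet.iUnion fun n =>
    antitone_comap_iterate hbi.measurable (Nat.le_add_left k n) _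
      ⟨_, hbi.measurableSet_iterate_image (n + k) hA, rfl⟩

theorem measurableSet_minimalInvariantSuperset (hbi : Bimeasurable φ) {A : Set Ω}
    (hA : MeasurableSet A) : MeasurableSet (minimalInvariantSuperset φ A) := by
  rw [minimalInvariantSuperset_eq_iUnion]
  exact MeasurableSet.iUnion fun m => MeasurableSet.iUnion fun n =>
    hbi.measurable.iterate m (hbi.measurableSet_iterate_image n hA)

theorem minimalInvariantSuperset_ae_eq (hφ : MeasurePreserving φ μ μ) (hbi : Bimeasurable φ)
    (h : ∀ A, MeasurableSet[tailSigma φ] A → φ ⁻¹' A =ᵐ[μ] A) {A : Set Ω}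
    (hA : MeasurableSet A) :
    (⋃ n : ℕ, φ^[n] ⁻¹' (φ^[n] '' A) : Set Ω) =ᵐ[μ] minimalInvariantSuperset φ A := by
  have hT := measurableSet_tailSigma_iUnion hbi hA
  set T : Set Ω := ⋃ n : ℕ, φ^[n] ⁻¹' (φ^[n] '' A) with hTdef
  refine EventuallyLE.antisymm (LE.le.eventuallyLE ?_) ?_
  · rw [minimalInvariantSuperset_eq_iUnion]
    exact Set.iUnion_subset fun n => Set.subset_iUnion₂ (s := fun m n => φ^[m] ⁻¹' (φ^[n] '' A)) n n
  · obtain ⟨B, hB, hBT, hBinv⟩ :=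
      hφ.quasiMeasurePreserving.exists_preimage_eq_of_preimage_ae
        (tailSigma_le φ T hT).nullMeasurableSet (h T hT)
    refine EventuallyLE.trans_eq ?_ hBT
    rw [ae_le_set, minimalInvariantSuperset_eq_iUnion, Set.iUnion_sdiff]
    refine measure_iUnion_null fun m => ?_
    rw [Set.iUnion_sdiff]
    refine measure_iUnion_null fun n => ?_
    have hms : MeasurableSet (φ^[m] ⁻¹' (φ^[n] '' A) \ B) :=
      (hbi.measurable.iterate m (hbi.measurableSet_iterate_image n hA)).diff hB
    have hTB : μ (T \ B) = 0 := ae_le_set.1 hBT.symm.le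
    -- Pulling back by `φⁿ` and using invariance of `B` turns the set into `φ⁻ᵐ(φ⁻ⁿ(φⁿ(A)) \ B)`,
    -- which lies in the null set `φ⁻ᵐ(T \ B)`.
    rw [← (hφ.iterate n).measure_preimage hms.nullMeasurableSet, Set.preimage_sdiff,
      preimage_iterate_eq hBinv, ← Set.preimage_comp, ← Function.iterate_add, add_comm,
      Function.iterate_add, Set.preimage_comp, ← preimage_iterate_eq hBinv m, ← Set.preimage_sdiff]
    refine (hφ.iterate m).quasiMeasurePreserving.preimage_null (measure_mono_null ?_ hTB)
    exact Set.sdiff_subset_sdiff_left (Set.subset_iUnion (fun n : ℕ => φ^[n] ⁻¹' (φ^[n] '' A)) n)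

theorem tendsto_image_iterate [IsProbabilityMeasure μ] (hφ : MeasurePreserving φ μ μ) (hbi : Bimeasurable φ)
    (h : ∀ A, MeasurableSet[tailSigma φ] A → φ ⁻¹' A =ᵐ[μ] A) {A : Set Ω}
    (hA : MeasurableSet A) :
    Tendsto (fun n : ℕ => MeasureAlgebra.mk μ (φ^[n] '' A) (hbi.measurableSet_iterate_image n hA))
      atTop (𝓝 (MeasureAlgebra.mk μ (minimalInvariantSuperset φ A)
        (measurableSet_minimalInvariantSuperset hbi hA))) := by
  rw [tendsto_iff_edist_tendsto_0]
  simp_rw [MeasureAlgebra.edist_mk]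
  have hsub := image_iterate_subset_minimalInvariantSuperset φ A
  -- Since `φⁿ(A) ⊆ A*`, the distance is a difference of measures, and continuity from below
  -- applies.
  have heq : ∀ n : ℕ, μ ((φ^[n] '' A) ∆ minimalInvariantSuperset φ A) =
      μ (minimalInvariantSuperset φ A) - μ (φ^[n] ⁻¹' (φ^[n] '' A)) := fun n => by
    have hn := (hbi.measurableSet_iterate_image n hA).nullMeasurableSet (μ := μ)
    rw [symmDiff_of_le (hsub n), (hφ.iterate n).measure_preimage hn,
      measure_sdiff (hsub n) hn (measure_ne_top _ _)]
  simp_rw [heq]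
  have hlim := tendsto_measure_iUnion_atTop (μ := μ) (monotone_preimage_image_iterate φ A)
  rw [measure_congr (minimalInvariantSuperset_ae_eq hφ hbi h hA)] at hlim
  simpa using ENNReal.Tendsto.sub (tendsto_const_nhds (x := μ (minimalInvariantSuperset φ A)))
    hlim (Or.inl (measure_ne_top _ _))

theorem preimage_ae_eq_of_tendsto_image (hφ : MeasurePreserving φ μ μ) (hbi : Bimeasurable φ)
    {A : Set Ω} (hAt : MeasurableSet[tailSigma φ] A) (hA : MeasurableSet A)
    {L : MeasureAlgebra μ}
    (hL : Tendsto (fun n : ℕ => MeasureAlgebra.mk μ (φ^[n] '' A)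
      (hbi.measurableSet_iterate_image n hA)) atTop (𝓝 L)) : φ ⁻¹' A =ᵐ[μ] A := by
  obtain ⟨⟨C, hC⟩, rfl⟩ := SeparationQuotient.surjective_mk L
  change Tendsto _ _ (𝓝 (MeasureAlgebra.mk μ C hC)) at hL
  rw [tendsto_iff_edist_tendsto_0] at hL
  simp_rw [MeasureAlgebra.edist_mk] at hL
  refine preimage_ae_eq_of_tendsto hφ hA hC (hL.congr fun n => ?_)
  rw [← (hφ.iterate n).measure_preimage
    ((hbi.measurableSet_iterate_image n hA).symmDiff hC).nullMeasurableSet,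
    Set.preimage_symmDiff, preimage_image_iterate_of_tailSigma hAt]

end Sets

/-! ### Powers of the Perron–Frobenius operator -/

section Functions

variable {Ω : Type*} [mΩ : MeasurableSpace Ω] {μ : Measure Ω} {φ : Ω → Ω}

theorem condExpInv_comp_iterate (hφ : MeasurePreserving φ μ μ) (n : ℕ) (f : Lp ℝ 1 μ) :
    condExpInv μ φ f ∘ φ^[n] =ᵐ[μ] μ[f | MeasurableSpace.invariants φ] := by
  have h : condExpInv μ φ f =ᵐ[μ] μ[f | MeasurableSpace.invariants φ] :=
    Integrable.coeFn_toL1 integrable_condExp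
  refine ((hφ.iterate n).quasiMeasurePreserving.ae_eq_comp h).trans (EventuallyEq.of_eq ?_)
  have hinv := MeasurableSpace.comp_eq_of_measurable_invariants
    (stronglyMeasurable_condExp (μ := μ) (f := f) (m := MeasurableSpace.invariants φ)).measurable
  induction n with
  | zero => rfl
  | succ n ih => rw [Function.iterate_succ', ← Function.comp_assoc, hinv, ih]

variable [IsProbabilityMeasure μ]

theorem setIntegral_perronFrobenius_pow (hφ : MeasurePreserving φ μ μ) (n : ℕ) (f : Lp ℝ 1 μ)
    {A : Set Ω} (hA : MeasurableSet A) :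
    ∫ x in A, (perronFrobenius hφ ^ n) f x ∂μ = ∫ x in φ^[n] ⁻¹' A, f x ∂μ := by
  induction n generalizing A with
  | zero => simp
  | succ n ih =>
    rw [pow_succ', mul_apply_eq_comp, setIntegral_perronFrobenius hφ _ hA,
      ih (hφ.measurable hA), ← Set.preimage_comp, Function.iterate_succ']

/-- Composing `Pⁿ f` with `φⁿ` yields the conditional expectation of `f` given `φ⁻ⁿ(Σ)`. -/
theorem perronFrobenius_pow_comp_iterate (hφ : MeasurePreserving φ μ μ) (n : ℕ) (f : Lp ℝ 1 μ) :
    (perronFrobenius hφ ^ n) f ∘ φ^[n] =ᵐ[μ] μ[f | MeasurableSpace.comap (φ^[n]) mΩ] := by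
  have hn := hφ.iterate n
  set g := (perronFrobenius hφ ^ n) f with hg
  refine ae_eq_condExp_of_forall_setIntegral_eq hn.measurable.comap_le (L1.integrable_coeFn f)
    (fun s _ _ => (hn.integrable_comp_of_integrable (L1.integrable_coeFn g)).integrableOn) ?_ ?_
  · rintro _ ⟨A, hA, rfl⟩ -
    rw [← setIntegral_perronFrobenius_pow hφ n f hA, ← hg]
    have := setIntegral_map (μ := μ) (g := φ^[n]) (f := g) hA
      (by rw [hn.map_eq]; exact Lp.aestronglyMeasurable g) hn.measurable.aemeasurable
    rw [hn.map_eq] at this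
    exact this.symm
  · exact ((Lp.stronglyMeasurable g).comp_measurable
      (comap_measurable (φ^[n]))).aestronglyMeasurable

theorem edist_perronFrobenius_pow (hφ : MeasurePreserving φ μ μ) (n : ℕ) (f g : Lp ℝ 1 μ) :
    edist ((perronFrobenius hφ ^ n) f) g =
      eLpNorm (μ[f | MeasurableSpace.comap (φ^[n]) mΩ] - g ∘ φ^[n]) 1 μ := by
  rw [Lp.edist_def, ← eLpNorm_comp_measurePreserving
    ((Lp.aestronglyMeasurable _).sub (Lp.aestronglyMeasurable _)) (hφ.iterate n)]
  exact eLpNorm_congr_ae ((perronFrobenius_pow_comp_iterate hφ n f).sub EventuallyEq.rfl)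

theorem tendsto_perronFrobenius_pow (hφ : MeasurePreserving φ μ μ)
    (h : ∀ A, MeasurableSet[tailSigma φ] A → φ ⁻¹' A =ᵐ[μ] A) (f : Lp ℝ 1 μ) :
    Tendsto (fun n : ℕ => (perronFrobenius hφ ^ n) f) atTop (𝓝 (condExpInv μ φ f)) := by
  rw [tendsto_iff_edist_tendsto_0]
  refine (tendsto_eLpNorm_condExp_iInf (antitone_comap_iterate hφ.measurable)
    (fun n => (hφ.measurable.iterate n).comap_le) (L1.integrable_coeFn f)).congr fun n => ?_
  rw [edist_perronFrobenius_pow]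
  refine eLpNorm_congr_ae (EventuallyEq.rfl.sub ?_)
  refine EventuallyEq.trans (EventuallyEq.symm ?_) (condExpInv_comp_iterate hφ n f).symm
  refine condExp_ae_eq_of_forall_exists_ae_eq (invariants_le_tailSigma φ) (tailSigma_le φ)
    (fun s hs => ?_) (L1.integrable_coeFn f)
  obtain ⟨t, ht, hts, htinv⟩ := hφ.quasiMeasurePreserving.exists_preimage_eq_of_preimage_ae
    (tailSigma_le φ s hs).nullMeasurableSet (h s hs)
  exact ⟨t, MeasurableSpace.measurableSet_invariants.2 ⟨ht, htinv⟩, hts.symm⟩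

/-- The Koopman isometry `U` satisfies `Uⁿ Pⁿ f = f` for the indicator `f` of a tail set, so `Pⁿ f →
g` gives `Uⁿ g → f`, whence `U f = f`. -/
theorem preimage_ae_eq_of_tendsto_perronFrobenius (hφ : MeasurePreserving φ μ μ) {A : Set Ω}
    (hAt : MeasurableSet[tailSigma φ] A) (hA : MeasurableSet A) {g : Lp ℝ 1 μ}
    (hg : Tendsto (fun n : ℕ => (perronFrobenius hφ ^ n)
      (indicatorConstLp 1 hA (measure_ne_top μ A) (1 : ℝ))) atTop (𝓝 g)) :
    φ ⁻¹' A =ᵐ[μ] A := by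
  set f := indicatorConstLp 1 hA (measure_ne_top μ A) (1 : ℝ) with hf
  let U : Lp ℝ 1 μ → Lp ℝ 1 μ := Lp.compMeasurePreserving φ hφ
  have hU : Isometry U := Lp.isometry_compMeasurePreserving hφ
  have hUi : ∀ n : ℕ, Isometry U^[n] := fun n => by
    rw [Lp.compMeasurePreserving_iterate]
    exact Lp.isometry_compMeasurePreserving (hφ.iterate n)
  have hUn : ∀ n : ℕ, U^[n] ((perronFrobenius hφ ^ n) f) = f := fun n => by
    have hm : AEStronglyMeasurable[MeasurableSpace.comap (φ^[n]) mΩ] f μ :=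
      (mem_lpMeas_indicatorConstLp (𝕜 := ℝ) (hφ.measurable.iterate n).comap_le
        (iInf_le (fun n : ℕ => MeasurableSpace.comap (φ^[n]) mΩ) n A hAt) (measure_ne_top μ A))
    rw [Lp.compMeasurePreserving_iterate]
    refine Lp.ext ((Lp.coeFn_compMeasurePreserving _ _).trans ?_)
    exact (perronFrobenius_pow_comp_iterate hφ n f).trans
      (condExp_of_aestronglyMeasurable' (hφ.measurable.iterate n).comap_le hm
        (L1.integrable_coeFn f))
  have hlim : Tendsto (fun n : ℕ => U^[n] g) atTop (𝓝 f) := by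
    rw [tendsto_iff_edist_tendsto_0] at hg ⊢
    refine hg.congr fun n => ?_
    conv_rhs => rw [← hUn n, (hUi n).edist_eq, edist_comm]
  have hlim' : Tendsto (fun n : ℕ => U^[n + 1] g) atTop (𝓝 (U f)) := by
    simp_rw [Function.iterate_succ_apply']
    exact (hU.continuous.tendsto f).comp hlim
  have hfix : U f = f := tendsto_nhds_unique hlim' (hlim.comp (tendsto_add_atTop_nat 1))
  rw [hf] at hfix
  change Lp.compMeasurePreserving φ hφ _ = _ at hfix
  rw [Lp.indicatorConstLp_compMeasurePreserving] at hfix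
  have h1 := indicatorConstLp_coeFn (p := 1) (hs := hφ.measurable hA)
    (hμs := measure_ne_top μ _) (c := (1 : ℝ))
  have h2 := indicatorConstLp_coeFn (p := 1) (hs := hA)
    (hμs := measure_ne_top μ _) (c := (1 : ℝ))
  rw [hfix] at h1
  filter_upwards [h1.symm.trans h2] with x hx
  have hmem : x ∈ φ ⁻¹' A ↔ x ∈ A := by
    by_cases h₁ : x ∈ φ ⁻¹' A <;> by_cases h₂ : x ∈ A <;>
      simp only [Set.indicator, if_pos, if_neg, h₁, h₂, not_false_eq_true, one_ne_zero,
        zero_ne_one] at hx ⊢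
  exact propext hmem

end Functions

end PerronFrobenius

theorem theorem1p1 {Ω : Type*} [MeasurableSpace Ω] (μ : Measure Ω) [IsProbabilityMeasure μ]
    (φ : Ω → Ω) (hφ : MeasurePreserving φ μ μ) (hbi : PerronFrobenius.Bimeasurable φ) :
    [∀ (A : Set Ω) (hA : MeasurableSet A), ∃ L : PerronFrobenius.MeasureAlgebra μ,
        Tendsto (fun n : ℕ => PerronFrobenius.MeasureAlgebra.mk μ (φ^[n] '' A)
          (hbi.measurableSet_iterate_image n hA)) atTop (𝓝 L),
      ∀ f : Lp ℝ 1 μ, ∃ g : Lp ℝ 1 μ,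
        Tendsto (fun n : ℕ => (PerronFrobenius.perronFrobenius hφ ^ n) f) atTop (𝓝 g),
      PerronFrobenius.completionWithin (PerronFrobenius.tailSigma φ) μ =
        PerronFrobenius.completionWithin (MeasurableSpace.invariants φ) μ].TFAE ∧
    (PerronFrobenius.completionWithin (PerronFrobenius.tailSigma φ) μ =
        PerronFrobenius.completionWithin (MeasurableSpace.invariants φ) μ →
      (∀ f : Lp ℝ 1 μ,
        Tendsto (fun n : ℕ => (PerronFrobenius.perronFrobenius hφ ^ n) f) atTop
          (𝓝 (PerronFrobenius.condExpInv μ φ f))) ∧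
      (∀ (A : Set Ω) (hA : MeasurableSet A),
        ∃ hA' : MeasurableSet (PerronFrobenius.minimalInvariantSuperset φ A),
          Tendsto (fun n : ℕ => PerronFrobenius.MeasureAlgebra.mk μ (φ^[n] '' A)
            (hbi.measurableSet_iterate_image n hA)) atTop
            (𝓝 (PerronFrobenius.MeasureAlgebra.mk μ
              (PerronFrobenius.minimalInvariantSuperset φ A) hA')))) := by
  -- Almost-everywhere invariance of tail sets replaces (iii) in both halves of the statement.
  rw [PerronFrobenius.completionWithin_eq_iff hφ]
  refine ⟨?_, fun h => ⟨PerronFrobenius.tendsto_perronFrobenius_pow hφ h, fun A hA =>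
    ⟨PerronFrobenius.measurableSet_minimalInvariantSuperset hbi hA,
      PerronFrobenius.tendsto_image_iterate hφ hbi h hA⟩⟩⟩
  tfae_have 3 → 1 := fun h A hA => ⟨_, PerronFrobenius.tendsto_image_iterate hφ hbi h hA⟩
  tfae_have 3 → 2 := fun h f => ⟨_, PerronFrobenius.tendsto_perronFrobenius_pow hφ h f⟩
  tfae_have 1 → 3 := fun h A hA =>
    let hA' := PerronFrobenius.tailSigma_le φ A hA
    PerronFrobenius.preimage_ae_eq_of_tendsto_image hφ hbi hA hA' (h A hA').choose_spec
  tfae_have 2 → 3 := fun h A hA =>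
    PerronFrobenius.preimage_ae_eq_of_tendsto_perronFrobenius hφ hA
      (PerronFrobenius.tailSigma_le φ A hA) (h _).choose_spec
  tfae_finish
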